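/- All graphs are simple; all graphs are finite. In the domination game on a graph $G$, Dominator and Staller alternately choose vertices; each chosen vertex must dominate (be equal or adjacent to) at least one vertex that was not dominated by the previously chosen vertices. The game ends when all vertices are dominated. Dominator wants the total number of moves to be as small as possible, Staller as large as possible. Let $\gamma_g'(G)$ be the number of moves when Staller moves first and both players play optimally. Let $Z$ be the graph on $v_1,\dots,v_9$ with edges $v_1v_2$, $v_2v_3$, $v_3v_4$, $v_4v_9$, $v_9v_8$, $v_8v_7$, $v_7v_6$, $v_6v_1$, $v_7v_2$, $v_8v_5$, $v_5v_4$, $v_5v_9$, $v_3v_8$, and let $z=v_9$. For $k\ge 0$, let $X_k$ be the graph obtained as follows. Add to $Z$ a new vertex $z'$ with the same closed neighborhood as $z$; take the disjoint union with a star $K_{1,5}$ with center $x$, one of whose leaves is denoted $x'$; add the edges $zx$ and $z'x'$; finally, take $k$ copies of the path $P_6$ on six vertices and identify one end vertex of each of them with $x$. Let $Q_k$ be the graph obtained in the same way with $Z$ replaced by the cycle $C_6$ and $z$ a vertex of $C_6$. In both cases let $e=z'x'$. **Proposition.** 1. For every $k\ge 0$ the graphs $X_k$ and $Q_k$ are connected,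 and $$\gamma_g'(X_k)=2k+7,\quad \gamma_g'(X_k-e)=2k+5,\qquad \gamma_g'(Q_k)=2k+6,\quad \gamma_g'(Q_k-e)=2k+4.$$ 2. For every integer $\ell\ge 6$ there is a connected graph $G$ with an edge $e$ such that $\gamma_g'(G)=\ell$ and $\gamma_g'(G-e)=\ell-2$. 3. For $\ell<6$ there is no graph $G$ with an edge $e$ such that $\gamma_g'(G)=\ell$ and $\gamma_g'(G-e)=\ell-2$. -/

import Mathlib

/-! ## The domination game -/

/-- The two players of the domination game. -/
inductive DominationPlayer where
  | dominator
  | staller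

/-- The closed neighbourhood `N[v]`, the set of vertices dominated by `v`. -/
noncomputable def closedNbhd {V : Type*} [Fintype V] (G : SimpleGraph V) (v : V) : Finset V :=
  open Classical in Finset.univ.filter fun w => w = v ∨ G.Adj v w

/-- The legal moves when `D` is the set of already dominated vertices: a chosen vertex has to
dominate at least one vertex outside `D`. -/
noncomputable def legalMoves {V : Type*} [Fintype V] (G : SimpleGraph V) (D : Finset V) :
    Finset V :=
  open Classical in Finset.univ.filter fun v => ∃ w ∈ closedNbhd G v, w ∉ D

theorem mem_closedNbhd {V : Type*} [Fintype V] {G : SimpleGraph V} {v w : V} :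
    w ∈ closedNbhd G v ↔ w = v ∨ G.Adj v w := by
  simp [closedNbhd]

theorem mem_legalMoves {V : Type*} [Fintype V] {G : SimpleGraph V} {D : Finset V} {v : V} :
    v ∈ legalMoves G D ↔ ∃ w ∈ closedNbhd G v, w ∉ D := by
  simp [legalMoves]

/-- A legal move is available exactly as long as some vertex is undominated. -/
theorem legalMoves_nonempty_iff {V : Type*} [Fintype V] {G : SimpleGraph V} {D : Finset V} :
    (legalMoves G D).Nonempty ↔ D ≠ Finset.univ := by
  constructor
  · rintro ⟨v, hv⟩ rfl
    obtain ⟨w, -, hw⟩ := mem_legalMoves.1 hv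
    exact hw (Finset.mem_univ w)
  · intro h
    have h' : ∃ w, w ∉ D := by
      by_contra hc
      push Not at hc
      exact h (Finset.eq_univ_iff_forall.2 hc)
    obtain ⟨w, hw⟩ := h'
    exact ⟨w, mem_legalMoves.2 ⟨w, mem_closedNbhd.2 (Or.inl rfl), hw⟩⟩

open Classical in
theorem card_compl_union_closedNbhd_lt {V : Type*} [Fintype V] {G : SimpleGraph V}
    {D : Finset V} {v : V} (hv : v ∈ legalMoves G D) :
    (Finset.univ \ (D ∪ closedNbhd G v)).card < (Finset.univ \ D).card := by
  obtain ⟨w, hw, hwD⟩ := mem_legalMoves.1 hv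
  refine Finset.card_lt_card (Finset.ssubset_iff_subset_ne.2
    ⟨Finset.sdiff_subset_sdiff le_rfl Finset.subset_union_left, fun h => ?_⟩)
  have h1 : w ∈ Finset.univ \ D := by simp [hwD]
  rw [← h] at h1
  simp [hw] at h1

open Classical in
/-- The number of moves still to be played under optimal play when the vertices of `D` are already
dominated and `p` is to move: `0` if all vertices are dominated; otherwise Dominator minimizes and
Staller maximizes the number of moves over all legal moves. -/
noncomputable def movesLeft {V : Type*} [Fintype V] (G : SimpleGraph V) :
    DominationPlayer → Finset V → ℕ
  | .dominator, D =>
    if h : D = Finset.univ then 0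
    else 1 + (legalMoves G D).attach.inf'
      (Finset.attach_nonempty_iff.2 (legalMoves_nonempty_iff.2 h))
      fun v => movesLeft G .staller (D ∪ closedNbhd G v.1)
  | .staller, D =>
    if h : D = Finset.univ then 0
    else 1 + (legalMoves G D).attach.sup'
      (Finset.attach_nonempty_iff.2 (legalMoves_nonempty_iff.2 h))
      fun v => movesLeft G .dominator (D ∪ closedNbhd G v.1)
termination_by _ D => (Finset.univ \ D).card
decreasing_by
  all_goals exact card_compl_union_closedNbhd_lt v.2

/-- The Staller-start game domination number `γ_g'(G)`. -/
noncomputable def stallerGameDomNumber {V : Type*} [Fintype V] (G : SimpleGraph V) : ℕ :=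
  movesLeft G .staller ∅

/-! ## The graphs `X_k` and `Q_k` -/

/-- The graph obtained from `G` by adding a new vertex `none` with the same closed neighbourhood
as the vertex `z`. -/
def addTwin {V : Type*} (G : SimpleGraph V) (z : V) : SimpleGraph (Option V) :=
  SimpleGraph.fromRel fun a b =>
    match a, b with
    | some a, some b => G.Adj a b
    | none, some b => b = z ∨ G.Adj z b
    | _, none => False

/-- The vertices of the graph obtained from a graph on `W` by adding a star `K_{1,5}` with `k`
paths hanging at its center `x`; a path `P_6` whose end vertex is identified with `x`
contributes five new vertices. -/
inductive GadgetVertex (W : Type*) (k : ℕ) where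
  | base (w : W)
  /-- The center of the star. -/
  | x
  /-- The distinguished leaf of the star. -/
  | x'
  /-- The four other leaves of the star. -/
  | leaf (i : Fin 4)
  /-- The vertex at distance `j + 1` from `x` on the `i`-th path. -/
  | path (i : Fin k) (j : Fin 5)
  deriving DecidableEq, Fintype

/-- Take the disjoint union of `H` and a star `K_{1,5}` with center `x` and a leaf `x'`, connect
`z` with `x` and `z'` with `x'`, and identify one end vertex of each of `k` copies of the path
`P_6` with `x`. -/
def gadget {W : Type*} (H : SimpleGraph W) (z z' : W) (k : ℕ) : SimpleGraph (GadgetVertex W k) :=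
  SimpleGraph.fromRel fun a b =>
    match a, b with
    | .base v, .base w => H.Adj v w
    | .base w, .x => w = z
    | .base w, .x' => w = z'
    | .x, .x' => True
    | .x, .leaf _ => True
    | .x, .path _ j => j.val = 0
    | .path i j, .path i' j' => i = i' ∧ j'.val = j.val + 1
    | _, _ => False

/-- The graph `Z` on nine vertices: the 8-cycle `0 1 2 3 8 7 6 5` with the chords `61` and `27`,
and a vertex `4` adjacent to `7`, `3` and `8`. -/
def graphZ : SimpleGraph (Fin 9) :=
  SimpleGraph.fromEdgeSet
    {s(0, 1), s(1, 2), s(2, 3), s(3, 8), s(8, 7), s(7, 6), s(6, 5), s(5, 0),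
      s(6, 1), s(2, 7), s(7, 4), s(4, 3), s(4, 8)}

/-- The graph `X_k`, built from `Z` with the vertex `z = 8` duplicated. -/
def graphX (k : ℕ) : SimpleGraph (GadgetVertex (Option (Fin 9)) k) :=
  gadget (addTwin graphZ 8) (some 8) none k

/-- The graph `Q_k`, built from the cycle `C_6` with the vertex `z = 0` duplicated. -/
def graphQ (k : ℕ) : SimpleGraph (GadgetVertex (Option (Fin 6)) k) :=
  gadget (addTwin (SimpleGraph.cycleGraph 6) 0) (some 0) none k

/-- The edge `e = z'x'` of `X_k` and of `Q_k`, where `z'` is the duplicate of `z`. -/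
def twinEdge (W : Type*) (k : ℕ) : Sym2 (GadgetVertex (Option W) k) :=
  s(.base none, .x')

open Classical in
/-- The set of dominated vertices after `v` is played when `D` is already dominated. -/
noncomputable def playMove {V : Type*} [Fintype V] (G : SimpleGraph V) (D : Finset V) (v : V) :
    Finset V :=
  D ∪ closedNbhd G v

section Game

variable {V : Type*} [Fintype V] {G : SimpleGraph V} {D D' : Finset V} {u v w : V}

theorem mem_playMove : w ∈ playMove G D v ↔ w ∈ D ∨ w ∈ closedNbhd G v := by
  simp [playMove]

theorem subset_playMove : D ⊆ playMove G D v := fun _ hw => mem_playMove.2 (Or.inl hw)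

theorem playMove_subset_playMove (h : D ⊆ D') : playMove G D v ⊆ playMove G D' v := fun _ hw =>
  mem_playMove.2 ((mem_playMove.1 hw).imp_left fun h' => h h')

theorem self_mem_playMove : v ∈ playMove G D v :=
  mem_playMove.2 (Or.inr (mem_closedNbhd.2 (Or.inl rfl)))

theorem mem_legalMoves_self (h : v ∉ D) : v ∈ legalMoves G D :=
  mem_legalMoves.2 ⟨v, mem_closedNbhd.2 (Or.inl rfl), h⟩

theorem playMove_eq_self (h : v ∉ legalMoves G D) : playMove G D v = D := by
  ext w
  rw [mem_playMove]
  refine ⟨?_, Or.inl⟩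
  rintro (hw | hw)
  · exact hw
  · by_contra hD
    exact h (mem_legalMoves.2 ⟨w, hw, hD⟩)

theorem legalMoves_anti (h : D ⊆ D') (hv : v ∈ legalMoves G D') : v ∈ legalMoves G D := by
  obtain ⟨w, hw, hD⟩ := mem_legalMoves.1 hv
  exact mem_legalMoves.2 ⟨w, hw, fun h' => hD (h h')⟩

theorem exists_mem_legalMoves (h : D ≠ Finset.univ) : ∃ v, v ∈ legalMoves G D :=
  legalMoves_nonempty_iff.2 h

theorem ne_univ_of_mem_legalMoves (h : v ∈ legalMoves G D) : D ≠ Finset.univ :=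
  legalMoves_nonempty_iff.1 ⟨v, h⟩

open Classical in
theorem card_compl_playMove_lt (hv : v ∈ legalMoves G D) :
    (Finset.univ \ playMove G D v).card < (Finset.univ \ D).card :=
  card_compl_union_closedNbhd_lt hv

variable (G) in
theorem movesLeft_univ (p : DominationPlayer) : movesLeft G p Finset.univ = 0 := by
  cases p <;> rw [movesLeft] <;> simp

theorem movesLeft_dominator_le (hv : v ∈ legalMoves G D) :
    movesLeft G .dominator D ≤ 1 + movesLeft G .staller (playMove G D v) := by
  rw [movesLeft, dif_neg (ne_univ_of_mem_legalMoves hv)]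
  exact Nat.add_le_add_left (Finset.inf'_le (fun v : {v // v ∈ legalMoves G D} =>
    movesLeft G .staller (playMove G D v.1)) (Finset.mem_attach _ ⟨v, hv⟩)) 1

theorem le_movesLeft_staller (hv : v ∈ legalMoves G D) :
    1 + movesLeft G .dominator (playMove G D v) ≤ movesLeft G .staller D := by
  rw [movesLeft.eq_2, dif_neg (ne_univ_of_mem_legalMoves hv)]
  exact Nat.add_le_add_left (Finset.le_sup' (fun v : {v // v ∈ legalMoves G D} =>
    movesLeft G .dominator (playMove G D v.1)) (Finset.mem_attach _ ⟨v, hv⟩)) 1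

theorem exists_movesLeft_dominator_eq (h : D ≠ Finset.univ) : ∃ v ∈ legalMoves G D,
    movesLeft G .dominator D = 1 + movesLeft G .staller (playMove G D v) := by
  rw [movesLeft, dif_neg h]
  obtain ⟨v, -, hv⟩ := Finset.exists_mem_eq_inf'
    (Finset.attach_nonempty_iff.2 (legalMoves_nonempty_iff.2 h))
    fun v : {v // v ∈ legalMoves G D} => movesLeft G .staller (playMove G D v.1)
  exact ⟨v.1, v.2, congrArg (1 + ·) hv⟩

theorem exists_movesLeft_staller_eq (h : D ≠ Finset.univ) : ∃ v ∈ legalMoves G D,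
    movesLeft G .staller D = 1 + movesLeft G .dominator (playMove G D v) := by
  rw [movesLeft.eq_2, dif_neg h]
  obtain ⟨v, -, hv⟩ := Finset.exists_mem_eq_sup'
    (Finset.attach_nonempty_iff.2 (legalMoves_nonempty_iff.2 h))
    fun v : {v // v ∈ legalMoves G D} => movesLeft G .dominator (playMove G D v.1)
  exact ⟨v.1, v.2, congrArg (1 + ·) hv⟩

theorem movesLeft_staller_le {n : ℕ}
    (h : ∀ v ∈ legalMoves G D, movesLeft G .dominator (playMove G D v) + 1 ≤ n) :
    movesLeft G .staller D ≤ n := by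
  by_cases hD : D = Finset.univ
  · simp [hD, movesLeft_univ]
  · obtain ⟨v, hv, h'⟩ := exists_movesLeft_staller_eq (G := G) hD
    have := h v hv
    omega

theorem le_movesLeft_dominator {n : ℕ} (hD : D ≠ Finset.univ)
    (h : ∀ v ∈ legalMoves G D, n ≤ movesLeft G .staller (playMove G D v) + 1) :
    n ≤ movesLeft G .dominator D := by
  obtain ⟨v, hv, h'⟩ := exists_movesLeft_dominator_eq (G := G) hD
  have := h v hv
  omega

/-- The continuation principle: dominating more vertices in advance does not prolong the game. -/
theorem movesLeft_anti (p : DominationPlayer) (h : D ⊆ D') :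
    movesLeft G p D' ≤ movesLeft G p D := by
  classical
  induction hn : (Finset.univ \ D).card using Nat.strong_induction_on generalizing p D D' with
  | _ n ih =>
    subst hn
    by_cases hD' : D' = Finset.univ
    · simp [hD', movesLeft_univ]
    have hD : D ≠ Finset.univ := fun h' => hD' (Finset.univ_subset_iff.1 (h' ▸ h))
    cases p with
    | staller =>
      refine movesLeft_staller_le fun v hv => ?_
      have hv' := legalMoves_anti h hv
      have h1 := ih _ (card_compl_playMove_lt hv') .dominator
        (playMove_subset_playMove (G := G) (v := v) h) rfl
      have h2 := le_movesLeft_staller hv'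
      omega
    | dominator =>
      obtain ⟨v, hv, h'⟩ := exists_movesLeft_dominator_eq (G := G) hD
      by_cases hv' : v ∈ legalMoves G D'
      · have h1 := ih _ (card_compl_playMove_lt hv) .staller
          (playMove_subset_playMove (G := G) (v := v) h) rfl
        have h2 := movesLeft_dominator_le hv'
        omega
      · obtain ⟨u, hu⟩ := exists_mem_legalMoves (G := G) hD'
        have hsub : playMove G D v ⊆ playMove G D' u := by
          have h1 := playMove_subset_playMove (G := G) (v := v) h
          rw [playMove_eq_self hv'] at h1
          exact h1.trans subset_playMove
        have h1 := ih _ (card_compl_playMove_lt hv) .staller hsub rfl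
        have h2 := movesLeft_dominator_le hu
        omega

variable (G D v) in
/-- The upper bound for Dominator given by a vertex `v`, be it a legal move or not. -/
theorem movesLeft_dominator_le_playMove :
    movesLeft G .dominator D ≤ 1 + movesLeft G .staller (playMove G D v) := by
  by_cases hv : v ∈ legalMoves G D
  · exact movesLeft_dominator_le hv
  by_cases hD : D = Finset.univ
  · simp [hD, movesLeft_univ]
  obtain ⟨u, hu⟩ := exists_mem_legalMoves (G := G) hD
  rw [playMove_eq_self hv]
  have h1 := movesLeft_dominator_le hu
  have h2 := movesLeft_anti (G := G) .staller (subset_playMove (G := G) (D := D) (v := u))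
  omega

variable (G D) in
theorem movesLeft_dominator_le_staller :
    movesLeft G .dominator D ≤ 1 + movesLeft G .staller D := by
  by_cases hD : D = Finset.univ
  · simp [hD, movesLeft_univ]
  obtain ⟨u, hu⟩ := exists_mem_legalMoves (G := G) hD
  have h1 := movesLeft_dominator_le hu
  have h2 := movesLeft_anti (G := G) .staller (subset_playMove (G := G) (D := D) (v := u))
  omega

theorem le_movesLeft {n : ℕ} (p : DominationPlayer) (hD : D ≠ Finset.univ)
    (h : ∀ v ∈ legalMoves G D, ∀ q, n ≤ movesLeft G q (playMove G D v)) :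
    n + 1 ≤ movesLeft G p D := by
  cases p with
  | dominator => exact le_movesLeft_dominator hD fun v hv => by have := h v hv .staller; omega
  | staller =>
    obtain ⟨v, hv⟩ := exists_mem_legalMoves (G := G) hD
    have h1 := le_movesLeft_staller hv
    have h2 := h v hv .dominator
    omega

theorem movesLeft_eq_zero_iff {p : DominationPlayer} :
    movesLeft G p D = 0 ↔ D = Finset.univ := by
  refine ⟨fun h => ?_, fun h => h ▸ movesLeft_univ G p⟩
  by_contra hD
  have := le_movesLeft (G := G) (n := 0) p hD fun _ _ _ => Nat.zero_le _
  omega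

end Game

section Subgraph

variable {V : Type*} [Fintype V] {G H : SimpleGraph V} {D D' : Finset V}

theorem playMove_subset_playMove_of_le (hHG : H ≤ G) (h : D ⊆ D') (v : V) :
    playMove H D v ⊆ playMove G D' v := by
  intro w hw
  rcases mem_playMove.1 hw with hw | hw
  · exact mem_playMove.2 (Or.inl (h hw))
  · exact mem_playMove.2 (Or.inr (mem_closedNbhd.2
      ((mem_closedNbhd.1 hw).imp_right fun h' => hHG h')))

theorem movesLeft_staller_le_one_of_le (hHG : H ≤ G) (h : D ⊆ D')
    (hH : movesLeft H .staller D ≤ 1) (v : V) (hv : v ∈ legalMoves H D) :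
    playMove G D' v = Finset.univ := by
  have h1 := le_movesLeft_staller hv
  have h2 : movesLeft H .dominator (playMove H D v) = 0 := by omega
  rw [movesLeft_eq_zero_iff] at h2
  exact Finset.univ_subset_iff.1 (h2 ▸ playMove_subset_playMove_of_le hHG h v)

/-- A Staller-start domination number `1` is not raised by additional edges. -/
theorem stallerGameDomNumber_le_one_of_le (hHG : H ≤ G) (hH : stallerGameDomNumber H ≤ 1) :
    stallerGameDomNumber G ≤ 1 := by
  refine movesLeft_staller_le fun v _ => ?_
  rw [movesLeft_staller_le_one_of_le hHG (Finset.Subset.refl ∅) hH v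
    (mem_legalMoves_self (Finset.notMem_empty v)), movesLeft_univ]

/-- Dominator's reply to a first move `s` in a game of at most `n + 2` moves. -/
theorem exists_reply {n : ℕ} (hH : stallerGameDomNumber H ≤ n + 2) (s : V) :
    ∃ d, movesLeft H .staller (playMove H (playMove H ∅ s) d) ≤ n := by
  have h1 := le_movesLeft_staller (G := H) (mem_legalMoves_self (Finset.notMem_empty s))
  unfold stallerGameDomNumber at hH
  by_cases hD : playMove H ∅ s = Finset.univ
  · refine ⟨s, ?_⟩
    have := movesLeft_anti (G := H) .staller
      (subset_playMove (G := H) (D := playMove H ∅ s) (v := s))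
    rw [hD, movesLeft_univ] at this
    rw [hD]
    omega
  · obtain ⟨d, -, hd⟩ := exists_movesLeft_dominator_eq (G := H) hD
    exact ⟨d, by omega⟩

/-- A Staller-start domination number `2` is not raised by additional edges. -/
theorem stallerGameDomNumber_le_two_of_le (hHG : H ≤ G) (hH : stallerGameDomNumber H ≤ 2) :
    stallerGameDomNumber G ≤ 2 := by
  refine movesLeft_staller_le fun s _ => ?_
  obtain ⟨d, hd⟩ := exists_reply (n := 0) hH s
  have h1 := movesLeft_dominator_le_playMove G (playMove G ∅ s) d
  have h2 : playMove G (playMove G ∅ s) d = Finset.univ := by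
    rw [Nat.le_zero, movesLeft_eq_zero_iff] at hd
    exact Finset.univ_subset_iff.1 (hd ▸ playMove_subset_playMove_of_le hHG
      (playMove_subset_playMove_of_le hHG (Finset.Subset.refl ∅) s) d)
  rw [h2, movesLeft_univ] at h1
  omega

/-- A Staller-start domination number `3` becomes at most `4` if edges are added. -/
theorem stallerGameDomNumber_le_four_of_le (hHG : H ≤ G) (hH : stallerGameDomNumber H ≤ 3) :
    stallerGameDomNumber G ≤ 4 := by
  refine movesLeft_staller_le fun s _ => ?_
  obtain ⟨d, hd⟩ := exists_reply (n := 1) hH s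
  have h1 := movesLeft_dominator_le_playMove G (playMove G ∅ s) d
  have hsub := playMove_subset_playMove_of_le hHG
      (playMove_subset_playMove_of_le hHG (Finset.Subset.refl ∅) s) d
  generalize playMove G (playMove G ∅ s) d = D' at *
  generalize playMove H (playMove H ∅ s) d = D at *
  suffices movesLeft G .staller D' ≤ 2 by omega
  refine movesLeft_staller_le fun t _ => ?_
  by_cases ht : playMove G D' t = Finset.univ
  · simp [ht, movesLeft_univ]
  obtain ⟨u, hu⟩ : ∃ u, u ∉ playMove G D' t := by
    by_contra h
    push Not at h
    exact ht (Finset.eq_univ_iff_forall.2 h)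
  have h2 := movesLeft_dominator_le_playMove G (playMove G D' t) u
  rw [movesLeft_staller_le_one_of_le hHG (hsub.trans subset_playMove) hd u
    (mem_legalMoves_self fun h => hu (subset_playMove (hsub h))), movesLeft_univ] at h2
  omega

/-- Deleting an edge cannot lower a Staller-start domination number below `6` by two. -/
theorem stallerGameDomNumber_ne_sub_two {e : Sym2 V} {l : ℕ} (hl : l < 6) (he : e ∈ G.edgeSet)
    (hG : stallerGameDomNumber G = l) :
    (stallerGameDomNumber (G.deleteEdges {e}) : ℤ) ≠ (l : ℤ) - 2 := by
  intro h
  have hHG : G.deleteEdges {e} ≤ G := SimpleGraph.deleteEdges_le _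
  have hpos : stallerGameDomNumber (G.deleteEdges {e}) ≠ 0 := by
    intro h0
    have h1 := movesLeft_eq_zero_iff.1 h0
    induction e using Sym2.ind with
    | _ a b => exact absurd (h1 ▸ Finset.mem_univ a) (Finset.notMem_empty a)
  have hle : stallerGameDomNumber (G.deleteEdges {e}) ≤ 3 := by omega
  have h4 := stallerGameDomNumber_le_four_of_le hHG hle
  by_cases h2 : stallerGameDomNumber (G.deleteEdges {e}) ≤ 2
  · have := stallerGameDomNumber_le_two_of_le hHG h2
    by_cases h3 : stallerGameDomNumber (G.deleteEdges {e}) ≤ 1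
    · have := stallerGameDomNumber_le_one_of_le hHG h3
      omega
    · omega
  · omega

end Subgraph

/-- The graph `G` arises from the graph `C`, embedded by `ι`, by hanging paths on five vertices
`π i 0, …, π i 4` at the vertex `x` of `C`; stated in terms of closed neighbourhoods. -/
structure HangsPaths {U V I : Type*} [Fintype U] [Fintype V] (C : SimpleGraph U)
    (G : SimpleGraph V) (x : U) (ι : U → V) (π : I → Fin 5 → V) : Prop where
  cover : ∀ v, (∃ u, v = ι u) ∨ ∃ i j, v = π i j
  core_core : ∀ u w, ι w ∈ closedNbhd G (ι u) ↔ w ∈ closedNbhd C u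
  core_path : ∀ u i j, π i j ∈ closedNbhd G (ι u) ↔ u = x ∧ j = 0
  path_core : ∀ u i j, ι u ∈ closedNbhd G (π i j) ↔ u = x ∧ j = 0
  path_path : ∀ i j i' j', π i' j' ∈ closedNbhd G (π i j) ↔
    i' = i ∧ j'.val ≤ j.val + 1 ∧ j.val ≤ j'.val + 1

/-- Dominator's answer on a path to Staller's move `j` on that path. -/
def pathReply (j : Fin 5) : Fin 5 := if j.val ≤ 2 then 3 else 1

theorem pathReply_covers : ∀ j j' : Fin 5, j' ≠ 0 →
    (j'.val ≤ j.val + 1 ∧ j.val ≤ j'.val + 1) ∨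
    (j'.val ≤ (pathReply j).val + 1 ∧ (pathReply j).val ≤ j'.val + 1) := by
  decide

theorem exists_not_near : ∀ j : Fin 5, ∃ j' : Fin 5, j' ≠ 0 ∧
    ¬ (j'.val ≤ j.val + 1 ∧ j.val ≤ j'.val + 1) := by
  decide

open Classical in
/-- The dominated vertices of the core. -/
noncomputable def corePart {U V : Type*} [Fintype U] (ι : U → V) (D : Finset V) : Finset U :=
  Finset.univ.filter fun u => ι u ∈ D

theorem mem_corePart {U V : Type*} [Fintype U] {ι : U → V} {D : Finset V} {u : U} :
    u ∈ corePart ι D ↔ ι u ∈ D := by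
  simp [corePart]

namespace HangsPaths

variable {U V I : Type*} [Fintype U] [Fintype V] {C : SimpleGraph U}
    {G : SimpleGraph V} {x : U} {ι : U → V} {π : I → Fin 5 → V} {D : Finset V}

theorem corePart_playMove_core (h : HangsPaths C G x ι π) (u : U) :
    corePart ι (playMove G D (ι u)) = playMove C (corePart ι D) u := by
  ext w
  simp only [mem_corePart, mem_playMove, h.core_core]

theorem corePart_playMove_path (h : HangsPaths C G x ι π) (hx : ι x ∈ D) (i : I) (j : Fin 5) :
    corePart ι (playMove G D (π i j)) = corePart ι D := by
  ext w
  simp only [mem_corePart, mem_playMove, h.path_core]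
  constructor
  · rintro (hw | ⟨rfl, -⟩) <;> assumption
  · exact Or.inl

theorem mem_playMove_path (h : HangsPaths C G x ι π) {i i' : I} {j j' : Fin 5} :
    π i' j' ∈ playMove G D (π i j) ↔
      π i' j' ∈ D ∨ i' = i ∧ j'.val ≤ j.val + 1 ∧ j.val ≤ j'.val + 1 := by
  rw [mem_playMove, h.path_path]

theorem mem_playMove_core (h : HangsPaths C G x ι π) {i : I} {j : Fin 5} {u : U} :
    π i j ∈ playMove G D (ι u) ↔ π i j ∈ D ∨ u = x ∧ j = 0 := by
  rw [mem_playMove, h.core_path]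

theorem eq_univ (h : HangsPaths C G x ι π) (hC : corePart ι D = Finset.univ)
    (hP : ∀ i j, π i j ∈ D) : D = Finset.univ := by
  rw [Finset.eq_univ_iff_forall]
  intro v
  rcases h.cover v with ⟨u, rfl⟩ | ⟨i, j, rfl⟩
  · exact mem_corePart.1 (hC ▸ Finset.mem_univ u)
  · exact hP i j

/-- Dominator's answer in a path completes it, except perhaps for the vertex next to the core. -/
theorem mem_playMove_reply (h : HangsPaths C G x ι π) {i : I} {j j' : Fin 5} (hj' : j' ≠ 0) :
    π i j' ∈ playMove G (playMove G D (π i j)) (π i (pathReply j)) := by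
  rw [h.mem_playMove_path, h.mem_playMove_path]
  rcases pathReply_covers j j' hj' with h' | h'
  · exact Or.inl (Or.inr ⟨rfl, h'⟩)
  · exact Or.inr ⟨rfl, h'⟩

/-- A legal move while `x` and its neighbours are dominated is a legal move in the core or a move
on a path that is not completely dominated. -/
theorem legal_cases (h : HangsPaths C G x ι π) (hx : ι x ∈ D) (h0 : ∀ i, π i 0 ∈ D) {v : V}
    (hv : v ∈ legalMoves G D) : (∃ u ∈ legalMoves C (corePart ι D), v = ι u) ∨
    ∃ i j j', v = π i j ∧ π i j' ∉ D ∧ j'.val ≤ j.val + 1 ∧ j.val ≤ j'.val + 1 := by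
  obtain ⟨w, hw, hD⟩ := mem_legalMoves.1 hv
  rcases h.cover v with ⟨u, rfl⟩ | ⟨i, j, rfl⟩
  · refine Or.inl ⟨u, ?_, rfl⟩
    rcases h.cover w with ⟨w, rfl⟩ | ⟨i, j, rfl⟩
    · exact mem_legalMoves.2 ⟨w, (h.core_core u w).1 hw, fun h' => hD (mem_corePart.1 h')⟩
    · exact absurd (((h.core_path _ _ _).1 hw).2 ▸ h0 i) hD
  · refine Or.inr ⟨i, j, ?_⟩
    rcases h.cover w with ⟨w, rfl⟩ | ⟨i', j', rfl⟩
    · exact absurd (((h.path_core _ _ _).1 hw).1 ▸ hx) hD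
    · obtain ⟨rfl, hj⟩ := (h.path_path _ _ _ _).1 hw
      exact ⟨j', rfl, hD, hj⟩

/-- If only paths are left, Dominator needs at most two moves for each of them, and one move for
each path in which only the second vertex is left. -/
theorem movesLeft_le_of_core_eq_univ (h : HangsPaths C G x ι π) [DecidableEq I] (n : ℕ)
    (p : DominationPlayer) (D : Finset V) (J T : Finset I) (hC : corePart ι D = Finset.univ)
    (h0 : ∀ i, π i 0 ∈ D) (hJ : ∀ i ∉ J, ∀ j, j ≠ 1 → π i j ∈ D)
    (hT : ∀ i, i ∉ J → i ∉ T → π i 1 ∈ D) (hn : 2 * J.card + T.card ≤ n) :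
    movesLeft G p D ≤ n := by
  induction n using Nat.strong_induction_on generalizing p D J T with
  | _ n ih =>
    have hx : ι x ∈ D := mem_corePart.1 (hC ▸ Finset.mem_univ x)
    have hmono : ∀ {D'}, D ⊆ D' → corePart ι D' = Finset.univ := fun hD => by
      rw [Finset.eq_univ_iff_forall]
      exact fun u => mem_corePart.2 (hD (mem_corePart.1 (hC ▸ Finset.mem_univ u)))
    have dropT : ∀ i ∈ T, ∀ q, movesLeft G q (playMove G D (π i 1)) ≤ n - 1 := by
      intro i hi q
      have hc := Finset.card_erase_add_one hi
      refine ih (n - 1) (by omega) q _ J (T.erase i) (hmono subset_playMove)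
        (fun i => subset_playMove (h0 i)) (fun i' hi' j hj => subset_playMove (hJ i' hi' j hj))
        (fun i' hi' hi'' => ?_) (by omega)
      by_cases hii : i' = i
      · subst hii
        exact self_mem_playMove
      · exact subset_playMove (hT i' hi' fun h' => hi'' (Finset.mem_erase.2 ⟨hii, h'⟩))
    cases p with
    | dominator =>
      by_cases hT0 : T.Nonempty
      · obtain ⟨i, hi⟩ := hT0
        have hc := Finset.card_erase_add_one hi
        have h1 := movesLeft_dominator_le_playMove G D (π i 1)
        have h2 := dropT i hi .staller
        omega
      by_cases hJ0 : J.Nonempty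
      · obtain ⟨i, hi⟩ := hJ0
        have hc := Finset.card_erase_add_one hi
        have hc' := Finset.card_insert_le i T
        have h1 := movesLeft_dominator_le_playMove G D (π i 3)
        have h2 : movesLeft G .staller (playMove G D (π i 3)) ≤ n - 1 := by
          refine ih (n - 1) (by omega) .staller _ (J.erase i) (insert i T)
            (hmono subset_playMove) (fun i => subset_playMove (h0 i)) (fun i' hi' j hj => ?_)
            (fun i' hi' hi'' => ?_) (by omega)
          · by_cases hii : i' = i
            · subst hii
              rcases eq_or_ne j 0 with rfl | hj0
              · exact subset_playMove (h0 _)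
              · refine h.mem_playMove_path.2 (Or.inr ⟨rfl, ?_⟩)
                revert hj hj0
                revert j
                decide
            · exact subset_playMove (hJ i' (fun h' => hi' (Finset.mem_erase.2 ⟨hii, h'⟩)) j hj)
          · rw [Finset.mem_insert, not_or] at hi''
            exact subset_playMove
              (hT i' (fun h' => hi' (Finset.mem_erase.2 ⟨hi''.1, h'⟩)) hi''.2)
        omega
      · rw [Finset.not_nonempty_iff_eq_empty] at hT0 hJ0
        subst hT0 hJ0
        have : D = Finset.univ := h.eq_univ hC fun i j => by
          rcases eq_or_ne j 1 with rfl | hj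
          · exact hT i (Finset.notMem_empty i) (Finset.notMem_empty i)
          · exact hJ i (Finset.notMem_empty i) j hj
        rw [this, movesLeft_univ]
        exact Nat.zero_le _
    | staller =>
      refine movesLeft_staller_le fun v hv => ?_
      rcases h.legal_cases hx h0 hv with ⟨u, hu, rfl⟩ | ⟨i, j, j', rfl, hj', hjj⟩
      · exact absurd hC (ne_univ_of_mem_legalMoves hu)
      by_cases hi : i ∈ J
      · have hc := Finset.card_erase_add_one hi
        have h1 := movesLeft_dominator_le_playMove G (playMove G D (π i j)) (π i (pathReply j))
        have h2 : movesLeft G .staller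
            (playMove G (playMove G D (π i j)) (π i (pathReply j))) ≤ n - 2 := by
          have key : ∀ j', π i j' ∈
              playMove G (playMove G D (π i j)) (π i (pathReply j)) := fun j' => by
            rcases eq_or_ne j' 0 with rfl | hj0
            · exact subset_playMove (subset_playMove (h0 i))
            · exact h.mem_playMove_reply hj0
          refine ih (n - 2) (by omega) .staller _ (J.erase i) T
            (hmono (subset_playMove.trans subset_playMove))
            (fun i => subset_playMove (subset_playMove (h0 i)))
            (fun i' hi' j hj => ?_) (fun i' hi' hi'' => ?_) (by omega)
          · by_cases hii : i' = i
            · exact hii ▸ key j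
            · exact subset_playMove (subset_playMove
                (hJ i' (fun h' => hi' (Finset.mem_erase.2 ⟨hii, h'⟩)) j hj))
          · by_cases hii : i' = i
            · exact hii ▸ key 1
            · exact subset_playMove (subset_playMove
                (hT i' (fun h' => hi' (Finset.mem_erase.2 ⟨hii, h'⟩)) hi''))
        omega
      · rcases eq_or_ne j' 1 with rfl | h1
        · have hiT : i ∈ T := by
            by_contra hiT
            exact hj' (hT i hi hiT)
          have hc := Finset.card_erase_add_one hiT
          have h3 : movesLeft G .dominator (playMove G D (π i j)) ≤ n - 1 := by
            refine ih (n - 1) (by omega) .dominator _ J (T.erase i) (hmono subset_playMove)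
              (fun i => subset_playMove (h0 i))
              (fun i' hi' j hj => subset_playMove (hJ i' hi' j hj))
              (fun i' hi' hi'' => ?_) (by omega)
            by_cases hii : i' = i
            · subst hii
              exact h.mem_playMove_path.2 (Or.inr ⟨rfl, hjj⟩)
            · exact subset_playMove (hT i' hi' fun h' => hi'' (Finset.mem_erase.2 ⟨hii, h'⟩))
          omega
        · exact absurd (hJ i hi j' h1) hj'

/-- Once `x` and its neighbours are dominated, each path adds at most two moves to the game on the
core. -/
theorem movesLeft_le (h : HangsPaths C G x ι π) [DecidableEq I] (n : ℕ)
    (p : DominationPlayer) (D : Finset V) (J : Finset I) (hx : ι x ∈ D)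
    (h0 : ∀ i, π i 0 ∈ D) (hJ : ∀ i ∉ J, ∀ j, π i j ∈ D)
    (hn : movesLeft C p (corePart ι D) + 2 * J.card ≤ n) :
    movesLeft G p D ≤ n := by
  induction n using Nat.strong_induction_on generalizing p D J with
  | _ n ih =>
    cases p with
    | dominator =>
      by_cases hC : corePart ι D = Finset.univ
      · exact h.movesLeft_le_of_core_eq_univ n .dominator D J ∅ hC h0
          (fun i hi j _ => hJ i hi j) (fun i hi _ => hJ i hi 1)
          (by rw [Finset.card_empty]; omega)
      · obtain ⟨u, hu, hu'⟩ := exists_movesLeft_dominator_eq (G := C) hC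
        have h1 := movesLeft_dominator_le_playMove G D (ι u)
        have h2 := ih (n - 1) (by omega) .staller (playMove G D (ι u)) J (subset_playMove hx)
          (fun i => subset_playMove (h0 i)) (fun i hi j => subset_playMove (hJ i hi j))
          (by rw [h.corePart_playMove_core]; omega)
        omega
    | staller =>
      refine movesLeft_staller_le fun v hv => ?_
      rcases h.legal_cases hx h0 hv with ⟨u, hu, rfl⟩ | ⟨i, j, j', rfl, hj', hjj⟩
      · have h1 := le_movesLeft_staller hu
        have h2 := ih (n - 1) (by omega) .dominator (playMove G D (ι u)) J (subset_playMove hx)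
          (fun i => subset_playMove (h0 i)) (fun i hi j => subset_playMove (hJ i hi j))
          (by rw [h.corePart_playMove_core]; omega)
        omega
      · have hi : i ∈ J := by
          by_contra hi
          exact hj' (hJ i hi j')
        have hc := Finset.card_erase_add_one hi
        have h1 := movesLeft_dominator_le_playMove G (playMove G D (π i j)) (π i (pathReply j))
        have h2 := ih (n - 2) (by omega) .staller
          (playMove G (playMove G D (π i j)) (π i (pathReply j))) (J.erase i)
          (subset_playMove (subset_playMove hx))
          (fun i => subset_playMove (subset_playMove (h0 i)))
          (fun i' hi' j' => by
            by_cases hii : i' = i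
            · subst hii
              rcases eq_or_ne j' 0 with rfl | hj0
              · exact subset_playMove (subset_playMove (h0 _))
              · exact h.mem_playMove_reply hj0
            · exact subset_playMove (subset_playMove
                (hJ i' (fun h' => hi' (Finset.mem_erase.2 ⟨hii, h'⟩)) j')))
          (by
            rw [h.corePart_playMove_path (subset_playMove hx), h.corePart_playMove_path hx]
            omega)
        omega

/-- Dominator answers on the paths until he can play `x`. -/
theorem movesLeft_staller_le_of_paths (h : HangsPaths C G x ι π) [DecidableEq I] {m : ℕ}
    (hm : movesLeft C .staller (closedNbhd C x) + 2 ≤ m) (n : ℕ) (D : Finset V) (J : Finset I)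
    (hJ : ∀ i ∉ J, ∀ j, j ≠ 0 → π i j ∈ D) (hn : J.card = n) :
    movesLeft G .staller D ≤ m + 2 * n := by
  induction n using Nat.strong_induction_on generalizing D J with
  | _ n ih =>
    have playx : ∀ v, (∀ i ∉ J, ∀ j, j ≠ 0 → π i j ∈ playMove G D v) →
        movesLeft G .dominator (playMove G D v) + 1 ≤ m + 2 * n := by
      intro v hv
      have h1 := movesLeft_dominator_le_playMove G (playMove G D v) (ι x)
      have h0 : ∀ i, π i 0 ∈ playMove G (playMove G D v) (ι x) := fun i =>
        h.mem_playMove_core.2 (Or.inr ⟨rfl, rfl⟩)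
      have hsub : closedNbhd C x ⊆ corePart ι (playMove G (playMove G D v) (ι x)) := by
        rw [h.corePart_playMove_core]
        exact fun w hw => mem_playMove.2 (Or.inr hw)
      have h2 := movesLeft_anti (G := C) .staller hsub
      have h3 := h.movesLeft_le _ .staller (playMove G (playMove G D v) (ι x)) J
        self_mem_playMove h0 (fun i hi j => by
          rcases eq_or_ne j 0 with rfl | hj
          · exact h0 i
          · exact subset_playMove (hv i hi j hj)) le_rfl
      omega
    refine movesLeft_staller_le fun v _ => ?_
    rcases h.cover v with ⟨u, rfl⟩ | ⟨i, j, rfl⟩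
    · exact playx _ fun i hi j hj => subset_playMove (hJ i hi j hj)
    by_cases hi : i ∈ J
    · have hc := Finset.card_erase_add_one hi
      have h1 := movesLeft_dominator_le_playMove G (playMove G D (π i j)) (π i (pathReply j))
      have h2 := ih (n - 1) (by omega)
        (playMove G (playMove G D (π i j)) (π i (pathReply j))) (J.erase i)
        (fun i' hi' j' hj' => by
          by_cases hii : i' = i
          · exact hii ▸ h.mem_playMove_reply hj'
          · exact subset_playMove (subset_playMove
              (hJ i' (fun h' => hi' (Finset.mem_erase.2 ⟨hii, h'⟩)) j' hj'))) (by omega)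
      omega
    · exact playx _ fun i hi j hj => subset_playMove (hJ i hi j hj)

/-- Each untouched path takes at least two moves, and each path with an undominated vertex off
the core takes at least one. -/
theorem le_movesLeft_of_paths (h : HangsPaths C G x ι π) [DecidableEq I] (n : ℕ)
    (p : DominationPlayer) (D : Finset V) (J T : Finset I) (hJ : ∀ i ∈ J, ∀ j, j ≠ 0 → π i j ∉ D)
    (hT : ∀ i ∈ T, ∃ j, j ≠ 0 ∧ π i j ∉ D) (hJT : Disjoint J T)
    (hn : n ≤ 2 * J.card + T.card) : n ≤ movesLeft G p D := by
  induction n generalizing p D J T with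
  | zero => exact Nat.zero_le _
  | succ n ih =>
    refine le_movesLeft p ?_ fun v _ q => ?_
    · rintro rfl
      have hJ0 : J = ∅ := Finset.eq_empty_of_forall_notMem fun i hi =>
        hJ i hi 1 (by decide) (Finset.mem_univ _)
      have hT0 : T = ∅ := Finset.eq_empty_of_forall_notMem fun i hi => by
        obtain ⟨j, -, hj⟩ := hT i hi
        exact hj (Finset.mem_univ _)
      simp [hJ0, hT0] at hn
    have stay : ∀ v i, (∀ j, j ≠ 0 → π i j ∉ closedNbhd G v) →
        ∀ j, j ≠ 0 → π i j ∉ D → π i j ∉ playMove G D v := by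
      intro v i hv j hj hD h'
      exact (mem_playMove.1 h').elim hD (hv j hj)
    have same : ∀ {i i' j j'}, i' ≠ i → π i' j' ∉ closedNbhd G (π i j) :=
      fun hne h' => hne ((h.path_path _ _ _ _).1 h').1
    rcases h.cover v with ⟨u, rfl⟩ | ⟨i, j, rfl⟩
    · have hu : ∀ i j, j ≠ 0 → π i j ∉ closedNbhd G (ι u) := fun i j hj h' =>
        hj ((h.core_path _ _ _).1 h').2
      refine ih q _ J T (fun i hi j hj => stay _ i (hu i) j hj (hJ i hi j hj))
        (fun i hi => ?_) hJT (by omega)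
      obtain ⟨j, hj, hD⟩ := hT i hi
      exact ⟨j, hj, stay _ i (hu i) j hj hD⟩
    · refine if hi : i ∈ J then ih q _ (J.erase i) (insert i T) (fun i' hi' j' hj' => ?_)
        (fun i' hi' => ?_) ?_ ?_ else ih q _ J (T.erase i) (fun i' hi' j' hj' => ?_)
        (fun i' hi' => ?_) ?_ ?_
      · obtain ⟨hne, hi'⟩ := Finset.mem_erase.1 hi'
        exact stay _ _ (fun _ _ => same hne) j' hj' (hJ i' hi' j' hj')
      · by_cases hne : i' = i
        · subst hne
          obtain ⟨j', hj', hjj⟩ := exists_not_near j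
          refine ⟨j', hj', fun h' => ?_⟩
          rcases h.mem_playMove_path.1 h' with h' | h'
          · exact hJ i' hi j' hj' h'
          · exact hjj h'.2
        · obtain ⟨j', hj', hD⟩ := hT i' (Finset.mem_of_mem_insert_of_ne hi' hne)
          exact ⟨j', hj', stay _ _ (fun _ _ => same hne) j' hj' hD⟩
      · rw [Finset.disjoint_insert_right]
        exact ⟨Finset.notMem_erase i J, hJT.mono_left (Finset.erase_subset i J)⟩
      · have hc := Finset.card_erase_add_one hi
        rw [Finset.card_insert_of_notMem (Finset.disjoint_left.1 hJT hi)]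
        omega
      · have hne : i' ≠ i := fun h' => hi (h' ▸ hi')
        exact stay _ _ (fun _ _ => same hne) j' hj' (hJ i' hi' j' hj')
      · obtain ⟨hne, hi'⟩ := Finset.mem_erase.1 hi'
        obtain ⟨j', hj', hD⟩ := hT i' hi'
        exact ⟨j', hj', stay _ _ (fun _ _ => same hne) j' hj' hD⟩
      · exact hJT.mono_right (Finset.erase_subset i T)
      · have hc := Finset.pred_card_le_card_erase (s := T) (a := i)
        omega

/-- Once `x` is dominated, each untouched path adds at least two moves to the game on the core. -/
theorem le_movesLeft (h : HangsPaths C G x ι π) [DecidableEq I] (p : DominationPlayer)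
    (D : Finset V) (J : Finset I) (hx : ι x ∈ D) (hJ : ∀ i ∈ J, ∀ j, j ≠ 0 → π i j ∉ D) :
    movesLeft C p (corePart ι D) + 2 * J.card ≤ movesLeft G p D := by
  classical
  induction hn : (Finset.univ \ D).card using Nat.strong_induction_on generalizing p D J with
  | _ n ih =>
    subst hn
    by_cases hD : D = Finset.univ
    · have hJ0 : J = ∅ := Finset.eq_empty_of_forall_notMem fun i hi =>
        hJ i hi 1 (by decide) (hD ▸ Finset.mem_univ _)
      have hC : corePart ι D = Finset.univ := by
        rw [Finset.eq_univ_iff_forall]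
        exact fun u => mem_corePart.2 (hD ▸ Finset.mem_univ _)
      simp [hJ0, hC, movesLeft_univ]
    have legal : ∀ {u}, u ∈ legalMoves C (corePart ι D) → ι u ∈ legalMoves G D := fun hu => by
      obtain ⟨w, hw, hw'⟩ := mem_legalMoves.1 hu
      exact mem_legalMoves.2 ⟨ι w, (h.core_core _ _).2 hw, fun h' => hw' (mem_corePart.2 h')⟩
    have core : ∀ u, ∀ i ∈ J, ∀ j, j ≠ 0 → π i j ∉ playMove G D (ι u) := fun u i hi j hj h' =>
      (h.mem_playMove_core.1 h').elim (hJ i hi j hj) fun h'' => hj h''.2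
    have path : ∀ i' j', ∀ i ∈ J.erase i', ∀ j, j ≠ 0 → π i j ∉ playMove G D (π i' j') :=
      fun i' j' i hi j hj h' => (h.mem_playMove_path.1 h').elim
        (hJ i (Finset.mem_of_mem_erase hi) j hj) fun h'' => Finset.ne_of_mem_erase hi h''.1
    cases p with
    | staller =>
      by_cases hC : corePart ι D = Finset.univ
      · rw [hC, movesLeft_univ]
        exact h.le_movesLeft_of_paths _ _ D J ∅ hJ (by simp) (Finset.disjoint_empty_right J)
          (by simp)
      · obtain ⟨u, hu, hu'⟩ := exists_movesLeft_staller_eq (G := C) hC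
        have h1 := le_movesLeft_staller (legal hu)
        have h2 := ih _ (card_compl_playMove_lt (legal hu)) .dominator (playMove G D (ι u)) J
          (subset_playMove hx) (core u) rfl
        rw [h.corePart_playMove_core] at h2
        omega
    | dominator =>
      refine le_movesLeft_dominator hD fun v hv => ?_
      have hlt := card_compl_playMove_lt hv
      rcases h.cover v with ⟨u, rfl⟩ | ⟨i, j, rfl⟩
      · have h2 := ih _ hlt .staller _ J (subset_playMove hx) (core u) rfl
        rw [h.corePart_playMove_core] at h2
        have h3 := movesLeft_dominator_le_playMove C (corePart ι D) u
        omega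
      by_cases hi : i ∈ J
      · obtain ⟨j', hj', hjj⟩ := exists_not_near j
        have hlegal : π i j' ∈ legalMoves G (playMove G D (π i j)) :=
          mem_legalMoves_self fun h' => (h.mem_playMove_path.1 h').elim (hJ i hi j' hj')
            fun h'' => hjj h''.2
        have h1 := le_movesLeft_staller hlegal
        have h2 := ih _ ((card_compl_playMove_lt hlegal).trans hlt) .dominator
          (playMove G (playMove G D (π i j)) (π i j')) (J.erase i)
          (subset_playMove (subset_playMove hx))
          (fun i' hi' j'' hj'' h' => (h.mem_playMove_path.1 h').elim
            (path i j i' hi' j'' hj'') fun h'' => Finset.ne_of_mem_erase hi' h''.1) rfl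
        rw [h.corePart_playMove_path (subset_playMove hx), h.corePart_playMove_path hx] at h2
        have hc := Finset.card_erase_add_one hi
        omega
      · have h2 := ih _ hlt .staller (playMove G D (π i j)) J (subset_playMove hx)
          (fun i' hi' => path i j i'
            (Finset.mem_erase.2 ⟨fun h' => hi (h' ▸ hi'), hi'⟩)) rfl
        rw [h.corePart_playMove_path hx] at h2
        have h3 := movesLeft_dominator_le_staller C (corePart ι D)
        omega

/-- If `x` is an optimal reply for Dominator in the core, and dominating `x` in advance does not
help him there, then each path adds exactly two moves. -/
theorem stallerGameDomNumber_eq [Fintype I] (h : HangsPaths C G x ι π) (hι : ι.Injective)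
    (hπ : ∀ i j, π i j ≠ ι x) {m : ℕ} (hle : movesLeft C .staller (closedNbhd C x) + 2 ≤ m)
    (hge : m ≤ movesLeft C .staller {x}) :
    stallerGameDomNumber G = 2 * Fintype.card I + m := by
  classical
  apply le_antisymm
  · have := h.movesLeft_staller_le_of_paths hle _ ∅ Finset.univ
      (fun i hi => absurd (Finset.mem_univ i) hi) rfl
    rw [Finset.card_univ] at this
    unfold stallerGameDomNumber
    omega
  · have h1 := h.le_movesLeft .staller {ι x} Finset.univ (Finset.mem_singleton_self _)
      (fun i _ j _ hij => hπ i j (Finset.mem_singleton.1 hij))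
    have h2 : corePart ι {ι x} = {x} := by
      ext u
      rw [mem_corePart, Finset.mem_singleton, Finset.mem_singleton, hι.eq_iff]
    have h3 := movesLeft_anti (G := G) .staller (Finset.empty_subset {ι x})
    rw [h2, Finset.card_univ] at h1
    unfold stallerGameDomNumber
    omega

end HangsPaths

/-- Whether Dominator can finish within `n` moves, where the closed neighbourhoods are given by the
binary digits of the numbers in `L`, the undominated vertices are the binary digits of `U`, and
the Boolean tells whether it is Staller's turn. -/
def domWithin (L : List ℕ) : ℕ → Bool → ℕ → Bool
  | 0, _, U => Nat.beq U 0
  | n + 1, true, U => L.all fun m =>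
    Nat.beq (U &&& m) 0 || domWithin L n false (U ^^^ (U &&& m))
  | n + 1, false, U => Nat.beq U 0 || L.any fun m => domWithin L n true (U ^^^ (U &&& m))

/-- Whether Staller can make the game last for at least `n` moves; see `domWithin`. -/
def domAtLeast (L : List ℕ) : ℕ → Bool → ℕ → Bool
  | 0, _, _ => true
  | n + 1, true, U => L.any fun m =>
    !Nat.beq (U &&& m) 0 && domAtLeast L n false (U ^^^ (U &&& m))
  | n + 1, false, U => !Nat.beq U 0 && L.all fun m =>
    Nat.beq (U &&& m) 0 || domAtLeast L n true (U ^^^ (U &&& m))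

/-- The Boolean of `domWithin` that stands for a player. -/
def DominationPlayer.isStaller : DominationPlayer → Bool
  | .dominator => false
  | .staller => true

/-- The binary digits of `U` are the undominated vertices, numbered by `idx`. -/
def EncodesUndominated {V : Type*} (idx : V → ℕ) (D : Finset V) (U : ℕ) : Prop :=
  ∀ i, U.testBit i = true ↔ ∃ v, v ∉ D ∧ idx v = i

/-- The list `L` holds the closed neighbourhoods of `G` as binary numbers, via `mask`. -/
structure EncodesGraph {V : Type*} [Fintype V] (G : SimpleGraph V) (idx : V → ℕ) (mask : V → ℕ)
    (L : List ℕ) : Prop where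
  inj : idx.Injective
  mem : ∀ m, m ∈ L ↔ ∃ v, mask v = m
  testBit : ∀ v w, (mask v).testBit (idx w) = true ↔ w ∈ closedNbhd G v

theorem land_eq_zero_iff {a b : ℕ} :
    a &&& b = 0 ↔ ∀ i, a.testBit i = true → b.testBit i = true → False := by
  constructor
  · intro h i ha hb
    have := Nat.testBit_and a b i
    rw [h, ha, hb] at this
    simp at this
  · intro h
    refine Nat.eq_of_testBit_eq fun i => ?_
    rw [Nat.testBit_and, Nat.zero_testBit]
    have := h i
    cases ha : a.testBit i <;> cases hb : b.testBit i <;> simp_all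

section Encoding

variable {V : Type*} [Fintype V] {G : SimpleGraph V} {idx mask : V → ℕ} {L : List ℕ}
    {D : Finset V} {U : ℕ}

theorem EncodesUndominated.eq_zero_iff (hU : EncodesUndominated idx D U) :
    U = 0 ↔ D = Finset.univ := by
  constructor
  · rintro rfl
    rw [Finset.eq_univ_iff_forall]
    intro v
    by_contra hv
    exact absurd ((hU (idx v)).2 ⟨v, hv, rfl⟩) (by simp)
  · rintro rfl
    refine Nat.eq_of_testBit_eq fun i => ?_
    rw [Nat.zero_testBit, Bool.eq_false_iff]
    intro h
    obtain ⟨v, hv, -⟩ := (hU i).1 h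
    exact hv (Finset.mem_univ v)

theorem EncodesGraph.legal_iff (hG : EncodesGraph G idx mask L)
    (hU : EncodesUndominated idx D U) {v : V} :
    v ∈ legalMoves G D ↔ U &&& mask v ≠ 0 := by
  rw [mem_legalMoves, Ne, land_eq_zero_iff]
  push Not
  constructor
  · rintro ⟨w, hw, hD⟩
    exact ⟨idx w, (hU _).2 ⟨w, hD, rfl⟩, (hG.testBit v w).2 hw, trivial⟩
  · rintro ⟨i, h1, h2, -⟩
    obtain ⟨w, hD, rfl⟩ := (hU i).1 h1
    exact ⟨w, (hG.testBit v w).1 h2, hD⟩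

theorem EncodesGraph.playMove (hG : EncodesGraph G idx mask L)
    (hU : EncodesUndominated idx D U) (v : V) :
    EncodesUndominated idx (playMove G D v) (U ^^^ (U &&& mask v)) := by
  intro i
  rw [Nat.testBit_xor, Nat.testBit_and]
  have h1 : (U.testBit i ^^ (U.testBit i && (mask v).testBit i)) = true ↔
      U.testBit i = true ∧ ¬ (mask v).testBit i = true := by
    cases U.testBit i <;> cases (mask v).testBit i <;> simp
  rw [h1, hU i]
  constructor
  · rintro ⟨⟨w, hw, rfl⟩, h⟩
    refine ⟨w, fun h' => ?_, rfl⟩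
    exact (mem_playMove.1 h').elim hw fun h'' => h ((hG.testBit v w).2 h'')
  · rintro ⟨w, hw, rfl⟩
    exact ⟨⟨w, fun h => hw (subset_playMove h), rfl⟩,
      fun h => hw (mem_playMove.2 (Or.inr ((hG.testBit v w).1 h)))⟩

theorem EncodesGraph.movesLeft_le (hG : EncodesGraph G idx mask L) (n : ℕ)
    (p : DominationPlayer) (D : Finset V) (U : ℕ) (hU : EncodesUndominated idx D U)
    (h : domWithin L n p.isStaller U = true) : movesLeft G p D ≤ n := by
  induction n generalizing p D U with
  | zero =>
    have h0 : U = 0 := by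
      cases p <;> exact Nat.eq_of_beq_eq_true h
    rw [hU.eq_zero_iff.1 h0, movesLeft_univ]
  | succ n ih =>
    cases p with
    | staller =>
      refine movesLeft_staller_le fun v hv => ?_
      have h1 := List.all_eq_true.1 h (mask v) ((hG.mem _).2 ⟨v, rfl⟩)
      rw [Bool.or_eq_true] at h1
      rcases h1 with h1 | h1
      · exact absurd (Nat.eq_of_beq_eq_true h1) ((hG.legal_iff hU).1 hv)
      · exact Nat.succ_le_succ (ih .dominator _ _ (hG.playMove hU v) h1)
    | dominator =>
      rcases (Bool.or_eq_true _ _).mp h with h1 | h1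
      · rw [hU.eq_zero_iff.1 (Nat.eq_of_beq_eq_true h1), movesLeft_univ]
        exact Nat.zero_le _
      · obtain ⟨m, hm, h2⟩ := List.any_eq_true.1 h1
        obtain ⟨v, rfl⟩ := (hG.mem m).1 hm
        have h3 := ih .staller _ _ (hG.playMove hU v) h2
        have h4 := movesLeft_dominator_le_playMove G D v
        omega

theorem EncodesGraph.le_movesLeft (hG : EncodesGraph G idx mask L) (n : ℕ)
    (p : DominationPlayer) (D : Finset V) (U : ℕ) (hU : EncodesUndominated idx D U)
    (h : domAtLeast L n p.isStaller U = true) : n ≤ movesLeft G p D := by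
  induction n generalizing p D U with
  | zero => exact Nat.zero_le _
  | succ n ih =>
    cases p with
    | staller =>
      obtain ⟨m, hm, h1⟩ := List.any_eq_true.1 h
      obtain ⟨v, rfl⟩ := (hG.mem m).1 hm
      rw [Bool.and_eq_true, Bool.not_eq_true'] at h1
      have hv := (hG.legal_iff (v := v) hU).2 (Nat.ne_of_beq_eq_false h1.1)
      have h3 := ih .dominator _ _ (hG.playMove hU v) h1.2
      have h4 := le_movesLeft_staller hv
      omega
    | dominator =>
      obtain ⟨h1, h2⟩ := (Bool.and_eq_true _ _).mp h
      rw [Bool.not_eq_true'] at h1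
      refine le_movesLeft_dominator
        (fun hD => Nat.ne_of_beq_eq_false h1 (hU.eq_zero_iff.2 hD)) fun v hv => ?_
      have h3 := List.all_eq_true.1 h2 (mask v) ((hG.mem _).2 ⟨v, rfl⟩)
      rw [Bool.or_eq_true] at h3
      rcases h3 with h3 | h3
      · exact absurd (Nat.eq_of_beq_eq_true h3) ((hG.legal_iff hU).1 hv)
      · exact Nat.succ_le_succ (ih .staller _ _ (hG.playMove hU v) h3)

end Encoding

/-- The embedding of the gadget without paths into the gadget with `k` paths. -/
def gadgetCore {W : Type*} (k : ℕ) : GadgetVertex W 0 → GadgetVertex W k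
  | .base w => .base w
  | .x => .x
  | .x' => .x'
  | .leaf i => .leaf i
  | .path i _ => i.elim0

section Gadget

variable {W : Type*}

theorem gadgetCore_injective (k : ℕ) : (gadgetCore k : GadgetVertex W 0 → _).Injective := by
  rintro (u | _ | _ | i | ⟨i, j⟩) (u' | _ | _ | i' | ⟨i', j'⟩) h <;>
    first | exact i.elim0 | exact i'.elim0 | simp_all [gadgetCore]

theorem gadgetCore_cover (k : ℕ) (v : GadgetVertex W k) :
    (∃ u, v = gadgetCore k u) ∨ ∃ i j, v = .path i j := by
  rcases v with u | _ | _ | i | ⟨i, j⟩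
  · exact Or.inl ⟨.base u, rfl⟩
  · exact Or.inl ⟨.x, rfl⟩
  · exact Or.inl ⟨.x', rfl⟩
  · exact Or.inl ⟨.leaf i, rfl⟩
  · exact Or.inr ⟨i, j, rfl⟩

theorem gadget_adj_core (H : SimpleGraph W) (z z' : W) (k : ℕ) (u w : GadgetVertex W 0) :
    (gadget H z z' k).Adj (gadgetCore k u) (gadgetCore k w) ↔ (gadget H z z' 0).Adj u w := by
  rcases u with u | _ | _ | i | ⟨i, j⟩ <;> rcases w with u' | _ | _ | i' | ⟨i', j'⟩ <;>
    first | exact i.elim0 | exact i'.elim0 | simp [gadgetCore, gadget]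

theorem gadget_adj_path (H : SimpleGraph W) (z z' : W) {k : ℕ} (i i' : Fin k) (j j' : Fin 5) :
    (gadget H z z' k).Adj (.path i j) (.path i' j') ↔
      i = i' ∧ (j'.val = j.val + 1 ∨ j.val = j'.val + 1) := by
  simp only [gadget, SimpleGraph.fromRel_adj, ne_eq, GadgetVertex.path.injEq]
  constructor
  · rintro ⟨-, ⟨rfl, h⟩ | ⟨rfl, h⟩⟩
    · exact ⟨rfl, Or.inl h⟩
    · exact ⟨rfl, Or.inr h⟩
  · rintro ⟨rfl, h⟩
    refine ⟨fun hj => ?_, h.imp (fun h => ⟨rfl, h⟩) fun h => ⟨rfl, h⟩⟩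
    rw [hj.2] at h
    omega

theorem gadget_adj_core_path (H : SimpleGraph W) (z z' : W) {k : ℕ} (u : GadgetVertex W 0)
    (i : Fin k) (j : Fin 5) :
    (gadget H z z' k).Adj (gadgetCore k u) (.path i j) ↔ u = .x ∧ j = 0 := by
  rcases u with u | _ | _ | i' | ⟨i', j'⟩ <;>
    first | exact i'.elim0 | simp [gadgetCore, gadget]

/-- Graphs with the adjacencies of the gadget on the paths are obtained by hanging paths. -/
theorem hangsPaths_of_adj {k : ℕ} {C : SimpleGraph (GadgetVertex W 0)}
    {G : SimpleGraph (GadgetVertex W k)} [Fintype W]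
    (hC : ∀ u w, G.Adj (gadgetCore k u) (gadgetCore k w) ↔ C.Adj u w)
    (hP : ∀ i i' j j', G.Adj (.path i j) (.path i' j') ↔
      i = i' ∧ (j'.val = j.val + 1 ∨ j.val = j'.val + 1))
    (hCP : ∀ u i j, G.Adj (gadgetCore k u) (.path i j) ↔ u = .x ∧ j = 0) :
    HangsPaths C G .x (gadgetCore k) .path where
  cover := gadgetCore_cover k
  core_core u w := by
    rw [mem_closedNbhd, mem_closedNbhd, (gadgetCore_injective k).eq_iff, hC]
  core_path u i j := by
    rw [mem_closedNbhd, hCP, or_iff_right]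
    rcases u with u | _ | _ | i' | ⟨i', j'⟩ <;> first | exact i'.elim0 | simp [gadgetCore]
  path_core u i j := by
    rw [mem_closedNbhd, G.adj_comm, hCP, or_iff_right]
    rcases u with u | _ | _ | i' | ⟨i', j'⟩ <;> first | exact i'.elim0 | simp [gadgetCore]
  path_path i j i' j' := by
    rw [mem_closedNbhd, hP, GadgetVertex.path.injEq, Fin.ext_iff (a := j')]
    constructor
    · rintro (⟨rfl, h⟩ | ⟨rfl, h⟩)
      · exact ⟨rfl, by omega⟩
      · exact ⟨rfl, by omega⟩
    · rintro ⟨rfl, h⟩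
      by_cases hj : j'.val = j.val
      · exact Or.inl ⟨rfl, hj⟩
      · exact Or.inr ⟨rfl, by omega⟩

theorem hangsPaths_gadget [Fintype W] (H : SimpleGraph W) (z z' : W) (k : ℕ) :
    HangsPaths (gadget H z z' 0) (gadget H z z' k) .x (gadgetCore k) .path :=
  hangsPaths_of_adj (gadget_adj_core H z z' k) (gadget_adj_path H z z')
    (gadget_adj_core_path H z z')

theorem hangsPaths_gadget_deleteEdges [Fintype W] (H : SimpleGraph W) (z z' : W) (k : ℕ) :
    HangsPaths ((gadget H z z' 0).deleteEdges {s(.base z', .x')})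
      ((gadget H z z' k).deleteEdges {s(.base z', .x')}) .x (gadgetCore k) .path := by
  refine hangsPaths_of_adj (fun u w => ?_) (fun i i' j j' => ?_) (fun u i j => ?_)
  · rw [SimpleGraph.deleteEdges_adj, SimpleGraph.deleteEdges_adj, gadget_adj_core]
    have : s(gadgetCore k u, gadgetCore k w) = Sym2.map (gadgetCore k) s(u, w) := rfl
    have h' : s(.base z', .x') = Sym2.map (gadgetCore (W := W) k) s(.base z', .x') := rfl
    rw [Set.mem_singleton_iff, Set.mem_singleton_iff, this, h',
      (Sym2.map.injective (gadgetCore_injective k)).eq_iff]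
  · rw [SimpleGraph.deleteEdges_adj, gadget_adj_path, and_iff_left]
    simp
  · rw [SimpleGraph.deleteEdges_adj, gadget_adj_core_path, and_iff_left]
    simp

theorem stallerGameDomNumber_of_hangsPaths [Fintype W] {k : ℕ}
    {C : SimpleGraph (GadgetVertex W 0)} {G : SimpleGraph (GadgetVertex W k)}
    (h : HangsPaths C G .x (gadgetCore k) .path) {m : ℕ}
    (hle : movesLeft C .staller (closedNbhd C .x) + 2 ≤ m) (hge : m ≤ movesLeft C .staller {.x}) :
    stallerGameDomNumber G = 2 * k + m := by
  have := h.stallerGameDomNumber_eq (gadgetCore_injective k) (fun i j => by simp [gadgetCore])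
    hle hge
  rwa [Fintype.card_fin] at this

theorem gadget_connected {H : SimpleGraph W} (z z' : W) (k : ℕ) (hH : H.Connected) :
    (gadget H z z' k).Connected := by
  have reach : ∀ v, (gadget H z z' k).Reachable v .x := by
    have hb : ∀ w, (gadget H z z' k).Reachable (.base w) .x := by
      intro w
      have h1 : (gadget H z z' k).Adj (.base z) .x := by simp [gadget]
      let f : H →g gadget H z z' k := ⟨GadgetVertex.base, fun {a b} hab => by
        simp [gadget, hab, hab.ne]⟩
      exact ((hH.preconnected w z).map f).trans h1.reachable
    rintro (w | _ | _ | i | ⟨i, j⟩)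
    · exact hb w
    · exact SimpleGraph.Reachable.refl _
    · exact SimpleGraph.Adj.reachable (by simp [gadget])
    · exact SimpleGraph.Adj.reachable (by simp [gadget])
    · obtain ⟨j, hj⟩ := j
      induction j with
      | zero => exact SimpleGraph.Adj.reachable (by simp [gadget])
      | succ j ih =>
        exact (SimpleGraph.Adj.reachable ((gadget_adj_path H z z' _ _ _ _).2
          ⟨rfl, Or.inr rfl⟩)).trans (ih (by omega))
  have : Nonempty (GadgetVertex W k) := ⟨.x⟩
  exact ⟨fun u v => (reach u).trans (reach v).symm⟩

theorem addTwin_connected {G : SimpleGraph W} (z : W) (hG : G.Connected) :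
    (addTwin G z).Connected := by
  have reach : ∀ v, (addTwin G z).Reachable v (some z) := by
    rintro (_ | v)
    · exact SimpleGraph.Adj.reachable (by simp [addTwin])
    · let f : G →g addTwin G z := ⟨some, fun {a b} hab => by simp [addTwin, hab, hab.ne]⟩
      exact (hG.preconnected v z).map f
  have : Nonempty (Option W) := ⟨none⟩
  exact ⟨fun u v => (reach u).trans (reach v).symm⟩

theorem twinEdge_mem_edgeSet (G : SimpleGraph W) (z : W) (k : ℕ) :
    twinEdge W k ∈ (gadget (addTwin G z) (some z) none k).edgeSet := by
  simp [twinEdge, gadget]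

end Gadget

section Decidable

variable {W : Type*} [DecidableEq W]

instance addTwin.decidableRel (G : SimpleGraph W) [DecidableRel G.Adj] (z : W) :
    DecidableRel (addTwin G z).Adj
  | some a, some b => inferInstanceAs (Decidable (some a ≠ some b ∧ (G.Adj a b ∨ G.Adj b a)))
  | none, some b => inferInstanceAs (Decidable (none ≠ some b ∧ ((b = z ∨ G.Adj z b) ∨ False)))
  | some a, none => inferInstanceAs (Decidable (some a ≠ none ∧ (False ∨ (a = z ∨ G.Adj z a))))
  | none, none => inferInstanceAs (Decidable ((none : Option W) ≠ none ∧ (False ∨ False)))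

/-- The adjacency of the gadget without paths as a Boolean function. -/
def gadgetAdjBool (H : SimpleGraph W) [DecidableRel H.Adj] (z z' : W) :
    GadgetVertex W 0 → GadgetVertex W 0 → Bool
  | .base v, .base w => H.Adj v w
  | .base w, .x => w = z
  | .x, .base w => w = z
  | .base w, .x' => w = z'
  | .x', .base w => w = z'
  | .x, .x' => true
  | .x', .x => true
  | .x, .leaf _ => true
  | .leaf _, .x => true
  | _, _ => false

theorem gadget_adj_iff_gadgetAdjBool (H : SimpleGraph W) [DecidableRel H.Adj] (z z' : W)
    (u v : GadgetVertex W 0) : (gadget H z z' 0).Adj u v ↔ gadgetAdjBool H z z' u v = true := by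
  rcases u with u | _ | _ | i | ⟨i, j⟩ <;> rcases v with u' | _ | _ | i' | ⟨i', j'⟩ <;>
    first
    | exact i.elim0
    | exact i'.elim0
    | (simp only [gadget, gadgetAdjBool, SimpleGraph.fromRel_adj, H.adj_comm u' u,
        decide_eq_true_iff, or_self, ne_eq, GadgetVertex.base.injEq, and_iff_right_iff_imp]; exact fun h => h.ne)
    | simp [gadget, gadgetAdjBool]

instance gadget.decidableRel (H : SimpleGraph W) [DecidableRel H.Adj] (z z' : W) :
    DecidableRel (gadget H z z' 0).Adj := fun u v =>
  decidable_of_iff _ (gadget_adj_iff_gadgetAdjBool H z z' u v).symm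

instance graphZ.decidableRel : DecidableRel graphZ.Adj := fun a b =>
  decidable_of_iff (s(a, b) ∈ ({s(0, 1), s(1, 2), s(2, 3), s(3, 8), s(8, 7), s(7, 6), s(6, 5),
    s(5, 0), s(6, 1), s(2, 7), s(7, 4), s(4, 3), s(4, 8)} : Finset (Sym2 (Fin 9))) ∧ a ≠ b)
    (by simp [graphZ])

end Decidable

/-- A numbering of the vertices of the gadget without paths. -/
def gadgetIdx {n : ℕ} : GadgetVertex (Option (Fin n)) 0 → ℕ
  | .base (some i) => i.val
  | .base none => n
  | .x => n + 1
  | .x' => n + 2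
  | .leaf i => n + 3 + i.val
  | .path i _ => i.elim0

theorem gadgetIdx_injective {n : ℕ} :
    (gadgetIdx : GadgetVertex (Option (Fin n)) 0 → ℕ).Injective := by
  rintro ((_ | u) | _ | _ | i | ⟨i, j⟩) ((_ | u') | _ | _ | i' | ⟨i', j'⟩) h <;>
    first
    | exact i.elim0
    | exact i'.elim0
    | (simp only [gadgetIdx] at h; first | rfl | omega | (congr 2; omega))

theorem exists_gadgetIdx_eq {n i : ℕ} (hi : i < n + 7) :
    ∃ v : GadgetVertex (Option (Fin n)) 0, gadgetIdx v = i := by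
  by_cases h1 : i < n
  · exact ⟨.base (some ⟨i, h1⟩), rfl⟩
  by_cases h2 : i = n
  · exact ⟨.base none, h2.symm⟩
  by_cases h3 : i = n + 1
  · exact ⟨.x, h3.symm⟩
  by_cases h4 : i = n + 2
  · exact ⟨.x', h4.symm⟩
  · exact ⟨.leaf ⟨i - (n + 3), by omega⟩, by simp only [gadgetIdx]; omega⟩

theorem encodesUndominated_gadget_empty {n : ℕ} :
    EncodesUndominated (V := GadgetVertex (Option (Fin n)) 0) gadgetIdx ∅ (2 ^ (n + 7) - 1) := by
  intro i
  rw [Nat.testBit_two_pow_sub_one, decide_eq_true_iff]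
  constructor
  · intro hi
    obtain ⟨v, hv⟩ := exists_gadgetIdx_eq hi
    exact ⟨v, Finset.notMem_empty v, hv⟩
  · rintro ⟨(_ | u) | _ | _ | i | ⟨i, j⟩, -, rfl⟩ <;>
      first | exact i.elim0 | (simp only [gadgetIdx]; omega)

theorem encodesUndominated_gadget_singleton {n : ℕ} :
    EncodesUndominated (V := GadgetVertex (Option (Fin n)) 0) gadgetIdx {.x}
      ((2 ^ (n + 7) - 1) ^^^ 2 ^ (n + 1)) := by
  intro i
  have h := encodesUndominated_gadget_empty (n := n) i
  rw [Nat.testBit_xor, Nat.testBit_two_pow]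
  by_cases hi : n + 1 = i
  · subst hi
    have h1 : (2 ^ (n + 7) - 1).testBit (n + 1) = true := by
      rw [Nat.testBit_two_pow_sub_one, decide_eq_true_iff]
      omega
    rw [h1]
    simp only [decide_true, bne_self_eq_false, Bool.false_eq_true, Finset.mem_singleton,
      false_iff, not_exists, not_and]
    exact fun v hv hv' => hv (gadgetIdx_injective (hv'.trans rfl))
  · rw [decide_eq_false hi, Bool.xor_false, h]
    refine exists_congr fun v => and_congr_left fun hv => ?_
    simp only [Finset.notMem_empty, not_false_iff, Finset.mem_singleton, true_iff]
    rintro rfl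
    exact hi hv

/-- The value of the game on a gadget whose graph without paths is encoded by the closed
neighbourhoods in `L`. -/
theorem stallerGameDomNumber_of_encoding {n k m : ℕ}
    {C : SimpleGraph (GadgetVertex (Option (Fin n)) 0)} [DecidableRel C.Adj]
    {G : SimpleGraph (GadgetVertex (Option (Fin n)) k)}
    (h : HangsPaths C G .x (gadgetCore k) .path) (L : List ℕ)
    (hmem : L.length = n + 7)
    (hL : ∀ u v : GadgetVertex (Option (Fin n)) 0,
      (L.getD (gadgetIdx u) 0).testBit (gadgetIdx v) = decide (v = u ∨ C.Adj u v))
    (hle : domWithin L m true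
      ((2 ^ (n + 7) - 1) ^^^ ((2 ^ (n + 7) - 1) &&& L.getD (n + 1) 0)) = true)
    (hge : domAtLeast L (m + 2) true ((2 ^ (n + 7) - 1) ^^^ 2 ^ (n + 1)) = true) :
    stallerGameDomNumber G = 2 * k + (m + 2) := by
  have hG : EncodesGraph C gadgetIdx (fun u => L.getD (gadgetIdx u) 0) L :=
    { inj := gadgetIdx_injective
      mem := fun a => by
        constructor
        · intro ha
          obtain ⟨i, hi, rfl⟩ := List.getElem_of_mem ha
          obtain ⟨v, rfl⟩ := exists_gadgetIdx_eq (n := n) (hmem ▸ hi)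
          exact ⟨v, List.getD_eq_getElem _ _ hi⟩
        · rintro ⟨v, rfl⟩
          have hv : gadgetIdx v < L.length := by
            have := (encodesUndominated_gadget_empty (gadgetIdx v)).2
              ⟨v, Finset.notMem_empty v, rfl⟩
            rw [Nat.testBit_two_pow_sub_one, decide_eq_true_iff] at this
            rwa [hmem]
          simp only [List.getD_eq_getElem _ _ hv]
          exact List.getElem_mem hv
      testBit := fun u v => by rw [hL, decide_eq_true_iff, mem_closedNbhd] }
  refine stallerGameDomNumber_of_hangsPaths h (Nat.add_le_add_right ?_ 2) ?_
  · have hsub : playMove C ∅ .x ⊆ closedNbhd C .x := fun w hw =>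
      (mem_playMove.1 hw).resolve_left (Finset.notMem_empty w)
    exact (movesLeft_anti .staller hsub).trans
      (hG.movesLeft_le m .staller _ _ (hG.playMove encodesUndominated_gadget_empty .x) hle)
  · exact hG.le_movesLeft (m + 2) .staller _ _ encodesUndominated_gadget_singleton hge

theorem graphZ_connected : graphZ.Connected := by
  have adj : ∀ {a b}, (decide (graphZ.Adj a b)) = true → graphZ.Reachable a b := fun h =>
    (of_decide_eq_true h).reachable
  have reach : ∀ v, graphZ.Reachable v 8 := by
    have h7 : graphZ.Reachable 7 8 := adj (by decide)
    have h6 : graphZ.Reachable 6 8 := (adj (b := 7) (by decide)).trans h7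
    have h5 : graphZ.Reachable 5 8 := (adj (b := 6) (by decide)).trans h6
    have h1 : graphZ.Reachable 1 8 := (adj (b := 6) (by decide)).trans h6
    intro v
    fin_cases v
    · exact (adj (b := 1) (by decide)).trans h1
    · exact h1
    · exact (adj (b := 7) (by decide)).trans h7
    · exact adj (by decide)
    · exact adj (by decide)
    · exact h5
    · exact h6
    · exact h7
    · exact SimpleGraph.Reachable.refl _
  exact ⟨fun u v => (reach u).trans (reach v).symm⟩

theorem stallerGameDomNumber_graphX (k : ℕ) : stallerGameDomNumber (graphX k) = 2 * k + 7 :=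
  stallerGameDomNumber_of_encoding (m := 5)
    (hangsPaths_gadget (addTwin graphZ 8) (some 8) none k)
    [35, 71, 142, 796, 920, 97, 226, 980, 1944, 2968, 64768, 3584, 5120, 9216, 17408, 33792]
    rfl (by decide +kernel) (by decide +kernel) (by decide +kernel)

theorem stallerGameDomNumber_graphX_deleteEdges (k : ℕ) :
    stallerGameDomNumber ((graphX k).deleteEdges {twinEdge (Fin 9) k}) = 2 * k + 5 :=
  stallerGameDomNumber_of_encoding (m := 3)
    (hangsPaths_gadget_deleteEdges (addTwin graphZ 8) (some 8) none k)
    [35, 71, 142, 796, 920, 97, 226, 980, 1944, 920, 64768, 3072, 5120, 9216, 17408, 33792]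
    rfl (by decide +kernel) (by decide +kernel) (by decide +kernel)

theorem stallerGameDomNumber_graphQ (k : ℕ) : stallerGameDomNumber (graphQ k) = 2 * k + 6 :=
  stallerGameDomNumber_of_encoding (m := 4)
    (hangsPaths_gadget (addTwin (SimpleGraph.cycleGraph 6) 0) (some 0) none k)
    [227, 71, 14, 28, 56, 113, 355, 8065, 448, 640, 1152, 2176, 4224]
    rfl (by decide +kernel) (by decide +kernel) (by decide +kernel)

theorem stallerGameDomNumber_graphQ_deleteEdges (k : ℕ) :
    stallerGameDomNumber ((graphQ k).deleteEdges {twinEdge (Fin 6) k}) = 2 * k + 4 :=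
  stallerGameDomNumber_of_encoding (m := 2)
    (hangsPaths_gadget_deleteEdges (addTwin (SimpleGraph.cycleGraph 6) 0) (some 0) none k)
    [227, 71, 14, 28, 56, 113, 99, 8065, 384, 640, 1152, 2176, 4224]
    rfl (by decide +kernel) (by decide +kernel) (by decide +kernel)

theorem graphX_connected (k : ℕ) : (graphX k).Connected :=
  gadget_connected _ _ k (addTwin_connected 8 graphZ_connected)

theorem graphQ_connected (k : ℕ) : (graphQ k).Connected :=
  gadget_connected _ _ k (addTwin_connected 0 SimpleGraph.cycleGraph_connected)

theorem mainTheorem9 :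
    -- the value `ℓ` is realized, by a connected graph, for every `ℓ ≥ 6`
    (∀ ℓ : ℕ, 6 ≤ ℓ →
      ∃ (V : Type) (_ : Fintype V) (G : SimpleGraph V) (e : Sym2 V),
        G.Connected ∧ e ∈ G.edgeSet ∧
        stallerGameDomNumber G = ℓ ∧ stallerGameDomNumber (G.deleteEdges {e}) = ℓ - 2) ∧
    -- the families `X_k` and `Q_k`
    (∀ k : ℕ, (graphX k).Connected ∧ twinEdge (Fin 9) k ∈ (graphX k).edgeSet ∧
      stallerGameDomNumber (graphX k) = 2 * k + 7 ∧
      stallerGameDomNumber ((graphX k).deleteEdges {twinEdge (Fin 9) k}) = 2 * k + 5) ∧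
    (∀ k : ℕ, (graphQ k).Connected ∧ twinEdge (Fin 6) k ∈ (graphQ k).edgeSet ∧
      stallerGameDomNumber (graphQ k) = 2 * k + 6 ∧
      stallerGameDomNumber ((graphQ k).deleteEdges {twinEdge (Fin 6) k}) = 2 * k + 4) ∧
    -- no `ℓ < 6` is realized
    (∀ ℓ : ℕ, ℓ < 6 →
      ¬ ∃ (V : Type*) (_ : Fintype V) (G : SimpleGraph V) (e : Sym2 V),
        e ∈ G.edgeSet ∧
        stallerGameDomNumber G = ℓ ∧
        (stallerGameDomNumber (G.deleteEdges {e}) : ℤ) = (ℓ : ℤ) - 2) := by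
  refine ⟨fun l hl => ?_,
    fun k => ⟨graphX_connected k, twinEdge_mem_edgeSet graphZ 8 k, stallerGameDomNumber_graphX k,
      stallerGameDomNumber_graphX_deleteEdges k⟩,
    fun k => ⟨graphQ_connected k, twinEdge_mem_edgeSet (SimpleGraph.cycleGraph 6) 0 k,
      stallerGameDomNumber_graphQ k, stallerGameDomNumber_graphQ_deleteEdges k⟩, ?_⟩
  · obtain ⟨k, rfl | rfl⟩ : ∃ k, l = 2 * k + 6 ∨ l = 2 * k + 7 := ⟨(l - 6) / 2, by omega⟩
    · exact ⟨_, inferInstance, graphQ k, twinEdge (Fin 6) k, graphQ_connected k,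
        twinEdge_mem_edgeSet (SimpleGraph.cycleGraph 6) 0 k, stallerGameDomNumber_graphQ k,
        stallerGameDomNumber_graphQ_deleteEdges k⟩
    · exact ⟨_, inferInstance, graphX k, twinEdge (Fin 9) k, graphX_connected k,
        twinEdge_mem_edgeSet graphZ 8 k, stallerGameDomNumber_graphX k,
        stallerGameDomNumber_graphX_deleteEdges k⟩
  · rintro l hl ⟨V, _, G, e, he, hG, h⟩
    exact stallerGameDomNumber_ne_sub_two hl he hG h
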